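/- **Setting.** Let $V:\mathbb R\to\mathbb R$ be even and continuously differentiable, with $\lim_{|t|\to\infty}V(t)/|t|^{1+\varepsilon}=\infty$ for some $\varepsilon>0$. Let $p:\mathbb Z^2\to[0,\infty)$ be finitely supported with $\sum_x p(x)=1$ and $p(-x)=p(x)$. Let $\eta=(\eta_i)_{i\in\mathbb Z^2}$ be i.i.d. real random variables with law $\mathbb P$ of $\eta$ on $\mathbb R^{\mathbb Z^2}$ (expectation $\mathbb E$), where $\eta_0$ and $-\eta_0$ have the same distribution and $0<\mathbb E(\eta_0^2)<\infty$. Write $i\sim j$ if $p(i-j)>0$. The gradient field of $\varphi\in\mathbb R^{\mathbb Z^2}$ is $\varphi'=(\varphi'_{ij})_{i\sim j}$ with $\varphi'_{ij}=\varphi_i-\varphi_j$; let $\Omega'$ be the set of all gradient fields, with the $\sigma$-algebra generated by the coordinates. For a finite $\Lambda\subset\mathbb Z^2$ and $\bar\varphi\in\mathbb R^{\mathbb Z^2}$ let $\mu_\Lambda^{\bar\varphi}[\eta]$ be the probability measure on fields $\varphi$ with $\varphi=\bar\varphi$ off $\Lambda$, under which $(\varphi_i)_{i\in\Lambda}$ has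 Lebesgue density proportional to $$\exp\Big\{-\tfrac12\sum_{i,j\in\Lambda}p(i-j)V(\varphi_i-\varphi_j)-\sum_{i\in\Lambda,\,j\in\Lambda^c}p(i-j)V(\varphi_i-\bar\varphi_j)+\sum_{i\in\Lambda}\eta_i\varphi_i\Big\},$$ and let $(\mu')_\Lambda^{\bar\varphi'}[\eta]$ be the law of $\varphi'$ under $\mu_\Lambda^{\bar\varphi}[\eta]$; it depends on $\bar\varphi$ only through $\bar\varphi'$. (If the above density is not integrable, which occurs only if $p(0)=1$ and $\Lambda\neq\emptyset$, these measures are taken to be zero.) A probability measure $\mu'$ on $\Omega'$ is a *gradient Gibbs measure* for $\eta$ if for all finite $\Lambda$ and all measurable $f:\Omega'\to[0,\infty]$ $$\int\mu'(d\bar\varphi')\int(\mu')_\Lambda^{\bar\varphi'}[\eta](d\varphi')\,f(\varphi')=\int\mu'(d\varphi')\,f(\varphi').$$ With $(\tau_r\eta)_i=\eta_{i-r}$ and $(\tau_r\varphi')_{ij}=\varphi'_{i-r,\,j-r}$, a *translation-covariant random gradient Gibbs measure* is a measurable map $\eta\mapsto\mu'[\eta]$ into measures on $\Omega'$ such that $\mu'[\eta]$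 is a gradient Gibbs measure for $\eta$ for $\mathbb P$-almost every $\eta$, and for every $r\in\mathbb Z^2$, for $\mathbb P$-almost every $\eta$, $\int\mu'[\tau_r\eta](d\varphi')F(\varphi')=\int\mu'[\eta](d\varphi')F(\tau_r\varphi')$ for all measurable $F:\Omega'\to[0,\infty]$. **Theorem 1.1 (Nonexistence in $d=2$).** There is no translation-covariant random gradient Gibbs measure $\mu'$ such that, for all $i\sim j$, the function $\varphi'\mapsto V'(\varphi'_{ij})$ is $\mu'[\eta]$-integrable for $\mathbb P$-almost every $\eta$, and $$\mathbb E\left|\int\mu'[\eta](d\varphi')\,V'(\varphi'_{ij})\right|<\infty .$$ -/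

import Mathlib

open MeasureTheory ProbabilityTheory Filter Topology
open scoped ENNReal

noncomputable section

namespace GradGibbs

/-- Sites of the lattice `ℤ^d`. -/
abbrev Site (d : ℕ) : Type := Fin d → ℤ

/-- Real-valued configurations on the lattice (height fields `φ` as well as disorder
configurations `η`), with the product σ-algebra. -/
abbrev Field (d : ℕ) : Type := Site d → ℝ

/-- `p` is the transition kernel of a symmetric random walk on `ℤ^d` of finite range. -/
structure IsWalkKernel {d : ℕ} (p : Site d → ℝ) : Prop where
  nonneg : ∀ x, 0 ≤ p x
  hasSum_one : HasSum p 1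
  symm : ∀ x, p (-x) = p x
  finite_range : p.support.Finite

/-- `V` is an even, continuously differentiable potential with
`V(t) / |t|^(1+ε) → ∞` as `|t| → ∞`, for some `ε > 0`. -/
structure IsPotential (V : ℝ → ℝ) : Prop where
  even : ∀ t, V (-t) = V t
  contDiff : ContDiff ℝ 1 V
  superlinear : ∃ ε : ℝ, 0 < ε ∧
    Tendsto (fun t : ℝ => V t / |t| ^ (1 + ε)) (cocompact ℝ) atTop

/-- `ν` is a symmetric distribution on the line with finite and nonzero second moment. -/
structure IsDisorderLaw (ν : Measure ℝ) : Prop where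
  isProbabilityMeasure : IsProbabilityMeasure ν
  symm : ν.map (fun x => -x) = ν
  memLp_two : MemLp (fun x : ℝ => x) 2 ν
  second_moment_ne_zero : ∫ x, x ^ 2 ∂ν ≠ 0

/-- The distribution `ℙ` of the disorder `η`: the `η_i` are i.i.d. with law `ν`. -/
def disorderMeasure (d : ℕ) (ν : Measure ℝ) : Measure (Field d) :=
  Measure.infinitePi (fun _ : Site d => ν)

/-- Oriented edges of the graph of the random walk: pairs `(i, j)` with `p (i - j) > 0`. -/
abbrev Edge {d : ℕ} (p : Site d → ℝ) : Type :=
  {e : Site d × Site d // 0 < p (e.1 - e.2)}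

/-- The space of gradient field configurations: the functions on oriented edges of the form
`(i, j) ↦ φ_i - φ_j`, with the σ-algebra generated by the evaluations at edges. -/
abbrev GradField {d : ℕ} (p : Site d → ℝ) : Type :=
  {ψ : Edge p → ℝ // ∃ φ : Field d, ∀ e : Edge p, ψ e = φ e.1.1 - φ e.1.2}

/-- The gradient field of a height field. -/
def grad {d : ℕ} (p : Site d → ℝ) (φ : Field d) : GradField p :=
  ⟨fun e => φ e.1.1 - φ e.1.2, φ, fun _ => rfl⟩

/-- A height field whose gradient field is the given one. The finite-volume gradient Gibbs
measures do not depend on this choice, see `map_grad_finiteGibbs_eq`. -/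
def heights {d : ℕ} {p : Site d → ℝ} (ψ : GradField p) : Field d := ψ.2.choose

theorem grad_heights {d : ℕ} {p : Site d → ℝ} (ψ : GradField p) : grad p (heights ψ) = ψ :=
  Subtype.ext (funext fun e => (ψ.2.choose_spec e).symm)

/-- The shift `(τ_r φ)_i = φ_{i - r}` of configurations on the lattice. -/
def shift {d : ℕ} (r : Site d) (φ : Field d) : Field d := fun i => φ (i - r)

/-- The edge `(i - r, j - r)`. -/
def edgeShift {d : ℕ} {p : Site d → ℝ} (r : Site d) (e : Edge p) : Edge p :=
  ⟨(e.1.1 - r, e.1.2 - r), by simpa using e.2⟩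

/-- The shift `(τ_r φ')_{ij} = φ'_{i - r, j - r}` of gradient fields. -/
def gradShift {d : ℕ} {p : Site d → ℝ} (r : Site d) (ψ : GradField p) : GradField p :=
  ⟨fun e => ψ.1 (edgeShift r e), shift r (heights ψ), fun e => ψ.2.choose_spec (edgeShift r e)⟩

/-- The configuration equal to `x` on `Λ` and to `b` off `Λ`. -/
def glue {d : ℕ} (Λ : Finset (Site d)) (b : Field d) (x : Λ → ℝ) : Field d :=
  fun i => if h : i ∈ Λ then x ⟨i, h⟩ else b i

/-- The energy in the finite volume `Λ` of a configuration `φ`, with the interaction between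
`Λ` and its complement and with the disorder `η` included. The sums over the sites off `Λ` have
finitely many nonzero terms when `p` has finite range. -/
def energy {d : ℕ} (p : Site d → ℝ) (V : ℝ → ℝ) (η : Field d) (Λ : Finset (Site d))
    (φ : Field d) : ℝ :=
  (1 / 2 : ℝ) * ∑ i ∈ Λ, ∑ j ∈ Λ, p (i - j) * V (φ i - φ j)
    + ∑ i ∈ Λ, ∑ᶠ (j : Site d) (_ : j ∉ Λ), p (i - j) * V (φ i - φ j)
    - ∑ i ∈ Λ, η i * φ i

/-- The Boltzmann weight of `x : Λ → ℝ` with boundary condition `b`. -/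
def weight {d : ℕ} (p : Site d → ℝ) (V : ℝ → ℝ) (η : Field d) (Λ : Finset (Site d))
    (b : Field d) (x : Λ → ℝ) : ℝ≥0∞ :=
  ENNReal.ofReal (Real.exp (-energy p V η Λ (glue Λ b x)))

/-- The partition function. -/
def partitionFn {d : ℕ} (p : Site d → ℝ) (V : ℝ → ℝ) (η : Field d) (Λ : Finset (Site d))
    (b : Field d) : ℝ≥0∞ :=
  ∫⁻ x : Λ → ℝ, weight p V η Λ b x

/-- The quenched finite-volume Gibbs measure in `Λ` with boundary condition `b`, as a measure
on all height fields. (It is the zero measure if the partition function is infinite.) -/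
def finiteGibbs {d : ℕ} (p : Site d → ℝ) (V : ℝ → ℝ) (η : Field d) (Λ : Finset (Site d))
    (b : Field d) : Measure (Field d) :=
  (partitionFn p V η Λ b)⁻¹ •
    ((volume : Measure (Λ → ℝ)).withDensity (weight p V η Λ b)).map (glue Λ b)

/-- The finite-volume gradient Gibbs measure in `Λ` with boundary condition `ψ`. -/
def finiteGradGibbs {d : ℕ} (p : Site d → ℝ) (V : ℝ → ℝ) (η : Field d) (Λ : Finset (Site d))
    (ψ : GradField p) : Measure (GradField p) :=
  (finiteGibbs p V η Λ (heights ψ)).map (grad p)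

/-- `μ` is a gradient Gibbs measure for the disorder `η`: a probability measure on gradient
fields that satisfies the DLR equation in every finite volume. -/
structure IsGradientGibbs {d : ℕ} (p : Site d → ℝ) (V : ℝ → ℝ) (η : Field d)
    (μ : Measure (GradField p)) : Prop where
  isProbabilityMeasure : IsProbabilityMeasure μ
  dlr : ∀ (Λ : Finset (Site d)) (f : GradField p → ℝ≥0∞), Measurable f →
    ∫⁻ ψ, ∫⁻ ψ', f ψ' ∂(finiteGradGibbs p V η Λ ψ) ∂μ = ∫⁻ ψ', f ψ' ∂μ

/-- `μ` (a measurable map `η ↦ μ[η]`) is a translation-covariant random gradient Gibbs measure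
for the disorder distribution `P`. -/
structure IsCovariantGradientGibbs {d : ℕ} (p : Site d → ℝ) (V : ℝ → ℝ)
    (P : Measure (Field d)) (μ : Kernel (Field d) (GradField p)) : Prop where
  gibbs : ∀ᵐ η ∂P, IsGradientGibbs p V η (μ η)
  covariant : ∀ r : Site d, ∀ᵐ η ∂P, ∀ f : GradField p → ℝ≥0∞, Measurable f →
    ∫⁻ ψ, f ψ ∂(μ (shift r η)) = ∫⁻ ψ, f (gradShift r ψ) ∂(μ η)

/-- The integrability condition `𝔼 |∫ μ[η](dφ') V'(φ'_{ij})| < ∞` for all edges `ij`: the inner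
integrals exist for almost every `η`, and they are integrable in `η`. -/
def HasIntegrableForce {d : ℕ} (p : Site d → ℝ) (V : ℝ → ℝ)
    (P : Measure (Field d)) (μ : Kernel (Field d) (GradField p)) : Prop :=
  ∀ e : Edge p,
    (∀ᵐ η ∂P, Integrable (fun ψ : GradField p => deriv V (ψ.1 e)) (μ η)) ∧
    Integrable (fun η => ∫ ψ, deriv V (ψ.1 e) ∂(μ η)) P

/-! Well-definedness of the finite-volume gradient Gibbs measures. -/

theorem measurable_glue {d : ℕ} (Λ : Finset (Site d)) (b : Field d) : Measurable (glue Λ b) := by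
  refine measurable_pi_lambda _ fun i => ?_
  by_cases h : i ∈ Λ
  · simpa [glue, h] using measurable_pi_apply _
  · simp [glue, h]

theorem measurable_grad {d : ℕ} (p : Site d → ℝ) : Measurable (grad p) := by
  unfold grad
  fun_prop

theorem grad_shift {d : ℕ} (p : Site d → ℝ) (r : Site d) (φ : Field d) :
    grad p (shift r φ) = gradShift r (grad p φ) := rfl

theorem energy_add {d : ℕ} {p : Site d → ℝ} (hp : ∀ x, 0 ≤ p x) (V : ℝ → ℝ) (η : Field d)
    (Λ : Finset (Site d)) (φ c : Field d) (hc : ∀ i j, 0 < p (i - j) → c i = c j) :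
    energy p V η Λ (φ + c) = energy p V η Λ φ - ∑ i ∈ Λ, η i * c i := by
  have key : ∀ i j, p (i - j) * V ((φ + c) i - (φ + c) j) = p (i - j) * V (φ i - φ j) := by
    intro i j
    rcases (hp (i - j)).eq_or_lt with h | h
    · simp [← h]
    · simp [hc i j h]
  unfold energy
  simp only [key]
  simp only [Pi.add_apply, mul_add, Finset.sum_add_distrib]
  ring

/-- Two height fields with the same gradient field induce the same finite-volume gradient Gibbs
measure. -/
theorem map_grad_finiteGibbs_eq {d : ℕ} {p : Site d → ℝ} (hp : ∀ x, 0 ≤ p x) (V : ℝ → ℝ)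
    (η : Field d) (Λ : Finset (Site d)) (b b' : Field d) (hb : grad p b = grad p b') :
    (finiteGibbs p V η Λ b).map (grad p) = (finiteGibbs p V η Λ b').map (grad p) := by
  set c : Field d := b' - b with hcdef
  have hc : ∀ i j, 0 < p (i - j) → c i = c j := by
    intro i j h
    have h1 := congrFun (congrArg Subtype.val hb) ⟨(i, j), h⟩
    simp only [grad] at h1
    simp only [hcdef, Pi.sub_apply]
    linarith
  set v : Λ → ℝ := fun i => c i.1 with hv
  have hglue : ∀ x, glue Λ b' (x + v) = glue Λ b x + c := by
    intro x
    funext i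
    by_cases h : i ∈ Λ <;> simp [glue, h, hv, hcdef]
  have hgrad : ∀ x, grad p (glue Λ b' (x + v)) = grad p (glue Λ b x) := by
    intro x
    refine Subtype.ext (funext fun e => ?_)
    have := hc _ _ e.2
    simp only [hglue, grad, Pi.add_apply]
    linarith
  set K : ℝ≥0∞ := ENNReal.ofReal (Real.exp (∑ i ∈ Λ, η i * c i)) with hK
  have hK0 : K ≠ 0 := by simp [hK, Real.exp_pos]
  have hKt : K ≠ ∞ := ENNReal.ofReal_ne_top
  have hw : ∀ x, weight p V η Λ b' (x + v) = K * weight p V η Λ b x := by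
    intro x
    rw [weight, weight, hglue, energy_add hp V η Λ _ c hc, hK,
      ← ENNReal.ofReal_mul (Real.exp_pos _).le, ← Real.exp_add]
    congr 2
    ring
  have hZ : partitionFn p V η Λ b' = K * partitionFn p V η Λ b := by
    unfold partitionFn
    rw [← lintegral_add_right_eq_self _ v]
    simp only [hw]
    exact lintegral_const_mul' _ _ hKt
  ext A hA
  have expand : ∀ b, (finiteGibbs p V η Λ b).map (grad p) A = (partitionFn p V η Λ b)⁻¹ *
      ∫⁻ x, ((fun x => grad p (glue Λ b x)) ⁻¹' A).indicator (weight p V η Λ b) x := by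
    intro b
    rw [finiteGibbs, Measure.map_apply (measurable_grad p) hA, Measure.smul_apply, smul_eq_mul,
      Measure.map_apply (measurable_glue Λ b) (measurable_grad p hA),
      withDensity_apply _ (measurable_glue Λ b (measurable_grad p hA)),
      ← lintegral_indicator (measurable_glue Λ b (measurable_grad p hA))]
    rfl
  rw [expand, expand, hZ, ← lintegral_add_right_eq_self
    (((fun x => grad p (glue Λ b' x)) ⁻¹' A).indicator (weight p V η Λ b')) v]
  have hind : ∀ x, ((fun x => grad p (glue Λ b' x)) ⁻¹' A).indicator (weight p V η Λ b') (x + v) =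
      K * ((fun x => grad p (glue Λ b x)) ⁻¹' A).indicator (weight p V η Λ b) x := by
    intro x
    by_cases h : grad p (glue Λ b x) ∈ A
    · rw [Set.indicator_of_mem, Set.indicator_of_mem, hw]
      · exact h
      · simpa [hgrad] using h
    · rw [Set.indicator_of_notMem, Set.indicator_of_notMem, mul_zero]
      · exact h
      · simpa [hgrad] using h
  simp only [hind]
  rw [lintegral_const_mul' _ _ hKt, ENNReal.mul_inv (Or.inl hK0) (Or.inl hKt)]
  rw [show ∀ a b c : ℝ≥0∞, a * b * (K * c) = (K * a) * (b * c) by intros; ring,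
    ENNReal.mul_inv_cancel hK0 hKt, one_mul]

end GradGibbs

end

noncomputable section

namespace GradGibbs

/-! ### Fluctuations of spatial sums over i.i.d. disorder -/

/-! Integrating by parts in the conditional law of the height at the origin shows that the mean
forces `V'` on the edges leaving the origin, weighted by `p`, add up to `η 0`
(`IsGradientGibbs.sum_force`). Since `V'` is odd, translation covariance identifies the force on
`(0, x)` with minus the translated force on `(0, -x)` (`IsCovariantGradientGibbs.force_negStep`).
Averaging the divergence identity with its reflection therefore writes `η 0` as a finite sum of
coboundaries of integrable functions of the disorder.

Such a representation is impossible in two dimensions (`IsDisorderLaw.not_sum_coboundary`). Summed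
over a box of side `L`, a coboundary telescopes to a difference of two sums over boundary layers of
`O(L)` sites. After centring, an `L¹` ergodic theorem uniform in the shape of the volume
(`hasSmallFluctuations`) makes these `o(L)` in `L¹`. The sum of the disorder over the `L ^ 2` sites
fluctuates at order `L` by the central limit theorem, so its `L¹` norm cannot be `o(L)`
(`IsDisorderLaw.not_tendsto_integral_abs_sum`). -/

theorem measurable_shift {d : ℕ} (r : Site d) : Measurable (shift r) :=
  measurable_pi_lambda _ fun _ => measurable_pi_apply _

theorem shift_shift {d : ℕ} (r s : Site d) (φ : Field d) :
    shift r (shift s φ) = shift (r + s) φ := by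
  funext i
  simp [shift, sub_sub]

instance isProbabilityMeasure_disorderMeasure {d : ℕ} (ν : Measure ℝ) [IsProbabilityMeasure ν] :
    IsProbabilityMeasure (disorderMeasure d ν) := by
  unfold disorderMeasure
  infer_instance

theorem measurePreserving_shift {d : ℕ} (ν : Measure ℝ) [IsProbabilityMeasure ν] (r : Site d) :
    MeasurePreserving (shift r) (disorderMeasure d ν) (disorderMeasure d ν) :=
  ⟨measurable_shift r,
    Measure.map_infinitePi_infinitePi_of_inj (P := fun _ : Site d => ν) (f := fun i => i - r)
      (sub_left_injective)⟩

/-- The centred sum of the translates of `Z` over the sites of `A`. -/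
def centredSum {d : ℕ} (P : Measure (Field d)) (Z : Field d → ℝ) (A : Finset (Site d))
    (η : Field d) : ℝ :=
  ∑ i ∈ A, (Z (shift (-i) η) - ∫ ω, Z ω ∂P)

/-- The centred sums of `Z` over `A` are `o(|A|)` in `L¹`, uniformly in the shape of `A`. -/
def HasSmallFluctuations {d : ℕ} (P : Measure (Field d)) (Z : Field d → ℝ) : Prop :=
  ∀ ε : ℝ, 0 < ε → ∃ C : ℝ, ∀ A : Finset (Site d),
    ∫ η, |centredSum P Z A η| ∂P ≤ ε * A.card + C * √(A.card : ℝ)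

section Fluctuations

variable {d : ℕ} {ν : Measure ℝ} [IsProbabilityMeasure ν]

theorem integrable_comp_shift {Z : Field d → ℝ} (hZ : Integrable Z (disorderMeasure d ν))
    (r : Site d) : Integrable (fun η => Z (shift r η)) (disorderMeasure d ν) :=
  (measurePreserving_shift ν r).integrable_comp_of_integrable hZ

theorem integral_comp_shift {Z : Field d → ℝ} (hZ : Integrable Z (disorderMeasure d ν))
    (r : Site d) :
    ∫ η, Z (shift r η) ∂(disorderMeasure d ν) = ∫ η, Z η ∂(disorderMeasure d ν) := by
  have h := measurePreserving_shift ν r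
  conv_rhs => rw [← h.map_eq]
  rw [integral_map h.measurable.aemeasurable]
  rw [h.map_eq]
  exact hZ.aestronglyMeasurable

theorem integrable_centredSum {Z : Field d → ℝ} (hZ : Integrable Z (disorderMeasure d ν))
    (A : Finset (Site d)) :
    Integrable (centredSum (disorderMeasure d ν) Z A) (disorderMeasure d ν) :=
  integrable_finsetSum _ fun _ _ => (integrable_comp_shift hZ _).sub (integrable_const _)

theorem integral_abs_centredSum_add_le {Z Z' : Field d → ℝ}
    (hZ : Integrable Z (disorderMeasure d ν)) (hZ' : Integrable Z' (disorderMeasure d ν))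
    (A : Finset (Site d)) :
    ∫ η, |centredSum (disorderMeasure d ν) (Z + Z') A η| ∂(disorderMeasure d ν) ≤
      ∫ η, |centredSum (disorderMeasure d ν) Z A η| ∂(disorderMeasure d ν) +
      ∫ η, |centredSum (disorderMeasure d ν) Z' A η| ∂(disorderMeasure d ν) := by
  rw [← integral_add (integrable_centredSum hZ A).abs (integrable_centredSum hZ' A).abs]
  refine integral_mono (integrable_centredSum (hZ.add hZ') A).abs
    ((integrable_centredSum hZ A).abs.add (integrable_centredSum hZ' A).abs) fun η => ?_
  have : centredSum (disorderMeasure d ν) (Z + Z') A η =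
      centredSum (disorderMeasure d ν) Z A η + centredSum (disorderMeasure d ν) Z' A η := by
    simp only [centredSum, ← Finset.sum_add_distrib]
    refine Finset.sum_congr rfl fun i _ => ?_
    simp only [Pi.add_apply]
    rw [integral_add hZ hZ']
    ring
  simp only [this]
  exact abs_add_le _ _

/-- A triangle-inequality bound that uses no independence; it controls the error when `Z` is
replaced by an `L¹` approximation. -/
theorem integral_abs_centredSum_le {Z : Field d → ℝ} (hZ : Integrable Z (disorderMeasure d ν))
    (A : Finset (Site d)) :
    ∫ η, |centredSum (disorderMeasure d ν) Z A η| ∂(disorderMeasure d ν) ≤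
      2 * A.card * ∫ η, |Z η| ∂(disorderMeasure d ν) := by
  set P := disorderMeasure d ν
  calc ∫ η, |centredSum P Z A η| ∂P
      ≤ ∫ η, ∑ i ∈ A, (|Z (shift (-i) η)| + ∫ ω, |Z ω| ∂P) ∂P := by
        refine integral_mono (integrable_centredSum hZ A).abs
          (integrable_finsetSum _ fun i _ =>
            (integrable_comp_shift hZ (-i)).abs.add (integrable_const _)) fun η => ?_
        refine (Finset.abs_sum_le_sum_abs _ _).trans (Finset.sum_le_sum fun i _ => ?_)
        exact (abs_sub _ _).trans (add_le_add le_rfl (abs_integral_le_integral_abs))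
    _ = 2 * A.card * ∫ η, |Z η| ∂P := by
        have hint : ∀ i ∈ A, Integrable (fun η => |Z (shift (-i) η)| + ∫ ω, |Z ω| ∂P) P :=
          fun i _ => (integrable_comp_shift hZ (-i)).abs.add (integrable_const _)
        rw [integral_finsetSum _ hint]
        have : ∀ i ∈ A, ∫ η, (|Z (shift (-i) η)| + ∫ ω, |Z ω| ∂P) ∂P = 2 * ∫ ω, |Z ω| ∂P := by
          intro i _
          rw [integral_add (integrable_comp_shift hZ (-i)).abs (integrable_const _),
            integral_comp_shift (Z := fun η => |Z η|) hZ.abs]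
          simp
          ring
        rw [Finset.sum_congr rfl this]
        simp
        ring

theorem HasSmallFluctuations.add {Z Z' : Field d → ℝ}
    (hZ : Integrable Z (disorderMeasure d ν)) (hZ' : Integrable Z' (disorderMeasure d ν))
    (h : HasSmallFluctuations (disorderMeasure d ν) Z)
    (h' : HasSmallFluctuations (disorderMeasure d ν) Z') :
    HasSmallFluctuations (disorderMeasure d ν) (Z + Z') := by
  intro ε hε
  obtain ⟨C, hC⟩ := h (ε / 2) (half_pos hε)
  obtain ⟨C', hC'⟩ := h' (ε / 2) (half_pos hε)
  refine ⟨C + C', fun A => (integral_abs_centredSum_add_le hZ hZ' A).trans ?_⟩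
  linarith [hC A, hC' A]

/-- An `L¹` error of `ε / 4` costs at most `2 * |A| * (ε / 4)`, which is half of the allowed linear
term; the approximant uses the other half. -/
theorem HasSmallFluctuations.of_approx {Z : Field d → ℝ}
    (hZ : Integrable Z (disorderMeasure d ν))
    (h : ∀ δ : ℝ, 0 < δ → ∃ Z' : Field d → ℝ, Integrable Z' (disorderMeasure d ν) ∧
      HasSmallFluctuations (disorderMeasure d ν) Z' ∧
      ∫ η, |Z η - Z' η| ∂(disorderMeasure d ν) ≤ δ) :
    HasSmallFluctuations (disorderMeasure d ν) Z := by
  intro ε hε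
  obtain ⟨Z', hZ', hf, hd⟩ := h (ε / 4) (by positivity)
  obtain ⟨C, hC⟩ := hf (ε / 2) (half_pos hε)
  refine ⟨C, fun A => ?_⟩
  have h1 := integral_abs_centredSum_add_le hZ' (hZ.sub hZ') A
  have h2 := integral_abs_centredSum_le (hZ.sub hZ') A
  have h3 : 2 * (A.card : ℝ) * ∫ η, |(Z - Z') η| ∂(disorderMeasure d ν) ≤
      2 * A.card * (ε / 4) := by
    gcongr
    exact hd
  rw [add_sub_cancel] at h1
  linarith [hC A]

/-- Jensen's inequality, read off from the nonnegativity of the variance of `|Y - E Y|`. -/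
theorem integral_abs_le_sqrt_variance {Ω : Type*} [MeasurableSpace Ω] {P : Measure Ω}
    [IsProbabilityMeasure P] {Y : Ω → ℝ} (hY : MemLp Y 2 P) :
    ∫ ω, |Y ω - ∫ ω', Y ω' ∂P| ∂P ≤ √(Var[Y; P]) := by
  have hW : MemLp (fun ω => |Y ω - ∫ ω', Y ω' ∂P|) 2 P :=
    (hY.sub (memLp_const _)).abs
  refine Real.le_sqrt_of_sq_le ?_
  have h := variance_nonneg (fun ω => |Y ω - ∫ ω', Y ω' ∂P|) P
  rw [variance_eq_sub hW] at h
  rw [variance_eq_integral hY.aestronglyMeasurable.aemeasurable]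
  simp only [Pi.pow_apply, sq_abs] at h
  linarith

/-- Translates of a local event are independent if their supports are disjoint. -/
theorem indepFun_cylinder_shift (K : Finset (Site d)) {S : Set (K → ℝ)} (hS : MeasurableSet S)
    (c : ℝ) {i j : Site d} (hij : ∀ k ∈ K, ∀ l ∈ K, k + i ≠ l + j) :
    IndepFun (fun η : Field d => (cylinder K S).indicator (fun _ => c) (shift (-i) η))
      (fun η => (cylinder K S).indicator (fun _ => c) (shift (-j) η))
      (disorderMeasure d ν) := by
  classical
  have hind : iIndepFun (fun (i : Site d) (η : Field d) => η i) (disorderMeasure d ν) :=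
    iIndepFun_infinitePi (X := fun _ x => x) fun _ => measurable_id
  have hdisj : Disjoint (K.image (· + i)) (K.image (· + j)) := by
    rw [Finset.disjoint_left]
    intro a ha hb
    obtain ⟨k, hk, rfl⟩ := Finset.mem_image.1 ha
    obtain ⟨l, hl, h⟩ := Finset.mem_image.1 hb
    exact hij k hk l hl h.symm
  have hcomp := hind.indepFun_finset _ _ hdisj fun i => measurable_pi_apply i
  let g (i : Site d) : ((K.image (· + i) : Finset (Site d)) → ℝ) → (K → ℝ) :=
    fun y k => y ⟨k.1 + i, Finset.mem_image_of_mem _ k.2⟩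
  have hg : ∀ i, Measurable (fun y => S.indicator (fun _ => c) (g i y)) := fun i =>
    (measurable_const.indicator hS).comp
      (measurable_pi_lambda _ fun k => measurable_pi_apply _)
  have key : ∀ (i : Site d) (η : Field d),
      (cylinder K S).indicator (fun _ => c) (shift (-i) η) =
      S.indicator (fun _ => c) (g i fun a => η a) := by
    intro i η
    have : (shift (-i) η ∈ cylinder K S) ↔ g i (fun a => η a) ∈ S := by
      rw [mem_cylinder]
      have : K.restrict (shift (-i) η) = g i (fun a => η a) := by
        funext k
        simp [g, shift, Finset.restrict]
      rw [this]
    simp only [Set.indicator, this]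
  simp only [key]
  exact hcomp.comp (hg i) (hg j)

/-- Translates of a local function have finite-range dependence, so the variance of their sum over
`A` is `O(|A|)` and the square-root term alone suffices. -/
theorem HasSmallFluctuations.indicator_cylinder (K : Finset (Site d)) {S : Set (K → ℝ)}
    (hS : MeasurableSet S) (c : ℝ) :
    HasSmallFluctuations (disorderMeasure d ν) ((cylinder K S).indicator fun _ => c) := by
  classical
  set P := disorderMeasure d ν with hP
  set Z : Field d → ℝ := (cylinder K S).indicator fun _ => c with hZdef
  have hZm : Measurable Z := measurable_const.indicator hS.cylinder
  have hZb : ∀ η, |Z η| ≤ |c| := fun η => by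
    by_cases h : η ∈ cylinder K S <;> simp [hZdef, h]
  have hX2 : ∀ i : Site d, MemLp (fun η => Z (shift (-i) η)) 2 P := fun i =>
    MemLp.of_bound (hZm.comp (measurable_shift _)).aestronglyMeasurable |c|
      (ae_of_all _ fun η => hZb _)
  have hZ : Integrable Z P :=
    Integrable.of_bound hZm.aestronglyMeasurable |c| (ae_of_all _ hZb)
  have hcov : ∀ i j : Site d,
      cov[fun η => Z (shift (-i) η), fun η => Z (shift (-j) η); P] ≤ 2 * c ^ 2 := by
    intro i j
    have hb1 : ∀ i, |∫ η, Z (shift (-i) η) ∂P| ≤ |c| := fun i => by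
      have := norm_integral_le_of_norm_le_const (μ := P) (f := fun η => Z (shift (-i) η))
        (ae_of_all _ fun η => hZb _)
      simpa using this
    have hb2 : |∫ η, Z (shift (-i) η) * Z (shift (-j) η) ∂P| ≤ |c| * |c| := by
      have := norm_integral_le_of_norm_le_const (μ := P) (C := |c| * |c|)
        (f := fun η => Z (shift (-i) η) * Z (shift (-j) η))
        (ae_of_all _ fun η => by
          rw [norm_mul]
          exact mul_le_mul (hZb _) (hZb _) (norm_nonneg _) (abs_nonneg _))
      simpa using this
    rw [covariance_eq_sub (hX2 i) (hX2 j)]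
    have h3 : |(∫ η, Z (shift (-i) η) ∂P) * ∫ η, Z (shift (-j) η) ∂P| ≤ |c| * |c| := by
      rw [abs_mul]
      exact mul_le_mul (hb1 i) (hb1 j) (abs_nonneg _) (abs_nonneg _)
    have h4 := (abs_le.1 hb2).2
    have h5 := (abs_le.1 h3).1
    rw [abs_mul_abs_self] at h4 h5
    simp only [Pi.mul_apply]
    nlinarith
  have hvar : ∀ A : Finset (Site d), Var[fun η => ∑ i ∈ A, Z (shift (-i) η); P] ≤
      A.card * ((K ×ˢ K).card * (2 * c ^ 2)) := by
    intro A
    rw [variance_fun_sum' fun i _ => hX2 i, ← nsmul_eq_mul]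
    refine Finset.sum_le_card_nsmul _ _ _ fun i _ => ?_
    -- The sites `j` for which `K + j` meets `K + i`; there are at most `|K|²` of them, whatever `i`
    -- is.
    set N : Finset (Site d) := (K ×ˢ K).image fun q => q.1 + i - q.2
    have hN : ∀ j, j ∉ N →
        cov[fun η => Z (shift (-i) η), fun η => Z (shift (-j) η); P] = 0 := by
      intro j hj
      refine (indepFun_cylinder_shift K hS c fun k hk l hl h => hj ?_).covariance_eq_zero
        (hX2 i) (hX2 j)
      exact Finset.mem_image.2 ⟨(k, l), Finset.mk_mem_product hk hl, by simp [h]⟩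
    calc ∑ j ∈ A, cov[fun η => Z (shift (-i) η), fun η => Z (shift (-j) η); P]
        = ∑ j ∈ A with j ∈ N, cov[fun η => Z (shift (-i) η), fun η => Z (shift (-j) η); P] := by
          rw [Finset.sum_filter]
          refine Finset.sum_congr rfl fun j _ => ?_
          split_ifs with h
          · rfl
          · exact hN j h
      _ ≤ ∑ j ∈ A with j ∈ N, 2 * c ^ 2 := Finset.sum_le_sum fun j _ => hcov i j
      _ ≤ (K ×ˢ K).card * (2 * c ^ 2) := by
          rw [Finset.sum_const, nsmul_eq_mul]
          gcongr
          exact (Finset.card_le_card fun j hj => (Finset.mem_filter.1 hj).2).trans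
            Finset.card_image_le
  intro ε hε
  refine ⟨√((K ×ˢ K).card * (2 * c ^ 2)), fun A => ?_⟩
  have h1 : ∀ η, centredSum P Z A η =
      (fun η => ∑ i ∈ A, Z (shift (-i) η)) η -
        ∫ η', (fun η => ∑ i ∈ A, Z (shift (-i) η)) η' ∂P := by
    intro η
    simp only [centredSum]
    rw [integral_finsetSum _ fun i _ => integrable_comp_shift hZ (-i), Finset.sum_sub_distrib]
    congr 1
    exact Finset.sum_congr rfl fun i _ => (integral_comp_shift hZ (-i)).symm
  simp only [h1]
  refine (integral_abs_le_sqrt_variance (memLp_finsetSum _ fun i _ => hX2 i)).trans ?_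
  refine (Real.sqrt_le_sqrt (hvar A)).trans ?_
  rw [Real.sqrt_mul (Nat.cast_nonneg _), mul_comm]
  have : 0 ≤ ε * A.card := by positivity
  linarith

/-- Cylinders form an algebra generating the product σ-algebra, so every event is approximated in
measure by local ones. -/
theorem measureDense_measurableCylinders (P : Measure (Field d)) [IsFiniteMeasure P] :
    P.MeasureDense (measurableCylinders fun _ : Site d => ℝ) :=
  Measure.MeasureDense.of_generateFrom_isSetAlgebra_finite P
    ⟨empty_mem_measurableCylinders _, fun _ h => compl_mem_measurableCylinders h,
      fun _ _ h h' => union_mem_measurableCylinders h h'⟩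
    generateFrom_measurableCylinders.symm

/-- Mean ergodic theorem in `L¹` for i.i.d. disorder, uniform in the shape of the volume. -/
theorem hasSmallFluctuations {Z : Field d → ℝ} (hZ : Integrable Z (disorderMeasure d ν)) :
    HasSmallFluctuations (disorderMeasure d ν) Z := by
  suffices h : Integrable Z (disorderMeasure d ν) ∧
      HasSmallFluctuations (disorderMeasure d ν) Z from h.2
  refine Integrable.induction (μ := disorderMeasure d ν)
    (fun Z => Integrable Z (disorderMeasure d ν) ∧
      HasSmallFluctuations (disorderMeasure d ν) Z) ?_ ?_ ?_ ?_ hZ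
  · intro c s hs _
    have hi : ∀ {t : Set (Field d)}, MeasurableSet t →
        Integrable (t.indicator fun _ => c) (disorderMeasure d ν) := fun ht =>
      (integrable_const c).indicator ht
    refine ⟨hi hs, .of_approx (hi hs) fun δ hδ => ?_⟩
    -- The tolerance has `|c| + 1` rather than `|c|` in the denominator to allow `c = 0`.
    obtain ⟨t, ht, hst⟩ := (measureDense_measurableCylinders (disorderMeasure d ν)).approx s hs
      (measure_ne_top _ _) (δ / (|c| + 1)) (by positivity)
    have htm := MeasurableSet.of_mem_measurableCylinders ht
    obtain ⟨K, S, hS, rfl⟩ := (mem_measurableCylinders t).1 ht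
    refine ⟨_, hi htm, .indicator_cylinder K hS c, ?_⟩
    have heq : ∀ η, |s.indicator (fun _ => c) η - (cylinder K S).indicator (fun _ => c) η| =
        (symmDiff s (cylinder K S)).indicator (fun _ => |c|) η := by
      intro η
      by_cases h1 : η ∈ s <;> by_cases h2 : η ∈ cylinder K S <;>
        simp [Set.mem_symmDiff, h1, h2]
    simp only [heq]
    rw [integral_indicator_const _ (hs.symmDiff htm), smul_eq_mul]
    have : (disorderMeasure d ν).real (symmDiff s (cylinder K S)) ≤ δ / (|c| + 1) :=
      ENNReal.toReal_le_of_le_ofReal (by positivity) hst.le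
    calc _ ≤ δ / (|c| + 1) * (|c| + 1) := by
          gcongr
          linarith
      _ = δ := by field_simp
  · rintro f g - hf hg ⟨_, hf'⟩ ⟨_, hg'⟩
    exact ⟨hf.add hg, hf'.add hf hg hg'⟩
  · refine isClosed_of_closure_subset fun f hf => ?_
    refine ⟨L1.integrable_coeFn f, .of_approx (L1.integrable_coeFn f) fun δ hδ => ?_⟩
    obtain ⟨g, hg, hfg⟩ := Metric.mem_closure_iff.1 hf δ hδ
    refine ⟨g, hg.1, hg.2, ?_⟩
    rw [L1.dist_eq_integral_dist] at hfg
    simpa [Real.dist_eq] using hfg.le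
  · rintro f g hfg hf ⟨_, hf'⟩
    have hg := hf.congr hfg
    refine ⟨hg, .of_approx hg fun δ hδ => ⟨f, hf, hf', ?_⟩⟩
    have : ∫ η, |g η - f η| ∂(disorderMeasure d ν) = 0 :=
      integral_eq_zero_of_ae (by filter_upwards [hfg] with η h; simp [h])
    linarith

end Fluctuations

/-! ### The disorder is not a sum of integrable coboundaries in two dimensions -/

/-- The box `[0, L)^d`. -/
def box (d L : ℕ) : Finset (Site d) := Fintype.piFinset fun _ => Finset.Ico (0 : ℤ) L

theorem card_box (d L : ℕ) : (box d L).card = L ^ d := by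
  simp [box]

/-- The part of a finite set moved out of it by a translation. -/
def outflow {d : ℕ} (A : Finset (Site d)) (x : Site d) : Finset (Site d) :=
  A.filter fun i => i + x ∉ A

theorem card_outflow_box_le (L : ℕ) (x : Site 2) :
    (outflow (box 2 L) x).card ≤ ((x 0).natAbs + (x 1).natAbs) * 2 * L := by
  classical
  -- Layers of thickness `|y|` at both ends of `[0, L)`: a coordinate pushed out by `y`, of either
  -- sign, lies in one of them.
  let D (y : ℤ) : Finset ℤ := Finset.Ico 0 (y.natAbs : ℤ) ∪ Finset.Ico (L - y.natAbs : ℤ) L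
  have hD : ∀ y, (D y).card ≤ y.natAbs * 2 := fun y => by
    refine (Finset.card_union_le _ _).trans ?_
    simp only [Int.card_Ico]
    omega
  let I : Finset ℤ := Finset.Ico 0 (L : ℤ)
  have hI : I.card = L := by simp [I]
  have hsub : outflow (box 2 L) x ⊆
      Fintype.piFinset ![D (x 0), I] ∪ Fintype.piFinset ![I, D (x 1)] := by
    intro i hi
    simp only [outflow, box, Finset.mem_filter, Fintype.mem_piFinset, Fin.forall_fin_two,
      Finset.mem_Ico, Pi.add_apply] at hi
    simp only [Finset.mem_union, Fintype.mem_piFinset, Fin.forall_fin_two, D, I,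
      Matrix.cons_val_zero, Matrix.cons_val_one, Finset.mem_Ico]
    omega
  refine (Finset.card_le_card hsub).trans ((Finset.card_union_le _ _).trans ?_)
  simp only [Fintype.card_piFinset, Fin.prod_univ_two, Matrix.cons_val_zero, Matrix.cons_val_one,
    hI]
  nlinarith [Nat.mul_le_mul_right L (hD (x 0)), Nat.mul_le_mul_right L (hD (x 1))]

/-- Discrete divergence theorem: the terms common to `A` and `A + x` cancel, leaving only boundary
layers. -/
theorem sum_sub_sum_translate {d : ℕ} (A : Finset (Site d)) (x : Site d) (u : Site d → ℝ) :
    ∑ i ∈ A, (u i - u (i + x)) =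
      ∑ i ∈ A \ A.map (addRightEmbedding x), u i - ∑ i ∈ A.map (addRightEmbedding x) \ A, u i := by
  rw [Finset.sum_sdiff_sub_sum_sdiff, Finset.sum_sub_distrib, Finset.sum_map]
  rfl

theorem card_map_sdiff {d : ℕ} (A : Finset (Site d)) (x : Site d) :
    (A.map (addRightEmbedding x) \ A).card = (outflow A x).card := by
  rw [← Finset.card_map (addRightEmbedding x) (s := outflow A x)]
  congr 1
  ext i
  simp only [Finset.mem_sdiff, Finset.mem_map, outflow, Finset.mem_filter]
  constructor
  · rintro ⟨⟨a, ha, rfl⟩, h⟩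
    exact ⟨a, ⟨ha, h⟩, rfl⟩
  · rintro ⟨a, ⟨ha, h⟩, rfl⟩
    exact ⟨⟨a, ha, rfl⟩, h⟩

theorem card_sdiff_map {d : ℕ} (A : Finset (Site d)) (x : Site d) :
    (A \ A.map (addRightEmbedding x)).card = (outflow A x).card := by
  rw [← card_map_sdiff]
  exact Finset.card_sdiff_comm (Finset.card_map _).symm

theorem IsDisorderLaw.integral_eq_zero {ν : Measure ℝ} (hν : IsDisorderLaw ν) : ∫ x, x ∂ν = 0 := by
  have h : ∫ x, x ∂ν = -∫ x, x ∂ν := by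
    conv_lhs => rw [← hν.symm]
    rw [integral_map (by fun_prop) (by fun_prop), integral_neg]
  linarith

section Coboundary

variable {ν : Measure ℝ} [IsProbabilityMeasure ν]

/-- In two dimensions, the sum over a box of side `L` of an integrable coboundary is `o(L)`. -/
theorem tendsto_integral_abs_sum_coboundary {Z : Field 2 → ℝ}
    (hZ : Integrable Z (disorderMeasure 2 ν)) (x : Site 2) :
    Tendsto (fun L : ℕ => (∫ η, |∑ i ∈ box 2 L, (Z (shift (-i) η) - Z (shift (-(i + x)) η))|
      ∂(disorderMeasure 2 ν)) / L) atTop (𝓝 0) := by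
  set P := disorderMeasure 2 ν with hP
  set k : ℕ := ((x 0).natAbs + (x 1).natAbs) * 2
  have hbound : ∀ ε : ℝ, 0 < ε → ∃ C : ℝ, ∀ L : ℕ, 0 < L →
      (∫ η, |∑ i ∈ box 2 L, (Z (shift (-i) η) - Z (shift (-(i + x)) η))| ∂P) / L ≤
        2 * ε * k + C * (√(L : ℝ))⁻¹ := by
    intro ε hε
    obtain ⟨C, hC⟩ := hasSmallFluctuations hZ ε hε
    refine ⟨2 * |C| * √(k : ℝ), fun L hL => ?_⟩
    have hLR : (0 : ℝ) < L := Nat.cast_pos.2 hL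
    set A := box 2 L
    set B := A.map (addRightEmbedding x)
    have hN : ((outflow A x).card : ℝ) ≤ k * L := by
      exact_mod_cast card_outflow_box_le L x
    have hone : ∀ D : Finset (Site 2), D.card = (outflow A x).card →
        ∫ η, |centredSum P Z D η| ∂P ≤ ε * (k * L) + |C| * √(k * L : ℝ) := by
      intro D hD
      refine (hC D).trans ?_
      rw [hD]
      gcongr
      exact le_abs_self C
    have hsum : ∫ η, |∑ i ∈ A, (Z (shift (-i) η) - Z (shift (-(i + x)) η))| ∂P ≤
        ∫ η, |centredSum P Z (A \ B) η| ∂P + ∫ η, |centredSum P Z (B \ A) η| ∂P := by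
      rw [← integral_add (integrable_centredSum hZ _).abs (integrable_centredSum hZ _).abs]
      refine integral_mono (integrable_finsetSum _ fun i _ =>
        (integrable_comp_shift hZ _).sub (integrable_comp_shift hZ _)).abs
        ((integrable_centredSum hZ _).abs.add (integrable_centredSum hZ _).abs) fun η => ?_
      -- Subtracting the mean changes no difference on the left, but makes the boundary sums
      -- centred.
      have := sum_sub_sum_translate A x fun i => Z (shift (-i) η) - ∫ ω, Z ω ∂P
      simp only [sub_sub_sub_cancel_right] at this
      simp only [this]
      exact abs_sub _ _
    have h1 := hone _ (card_sdiff_map A x)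
    have h2 := hone _ (card_map_sdiff A x)
    rw [div_le_iff₀ hLR]
    refine (hsum.trans (add_le_add h1 h2)).trans (le_of_eq ?_)
    rw [Real.sqrt_mul (Nat.cast_nonneg _), add_mul]
    have : (√(L : ℝ))⁻¹ * L = √(L : ℝ) := by
      rw [inv_mul_eq_div, Real.div_sqrt]
    rw [mul_assoc (2 * |C| * √(k : ℝ)), this]
    ring
  rw [Metric.tendsto_atTop']
  intro δ hδ
  -- This makes the term `2 * ε * k` at most `δ / 2`; the `+ 1` covers `k = 0`.
  obtain ⟨C, hC⟩ := hbound (δ / (4 * (k + 1))) (by positivity)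
  have hlim : Tendsto (fun L : ℕ => C * (√(L : ℝ))⁻¹) atTop (𝓝 (C * 0)) :=
    ((tendsto_inv_atTop_zero.comp Real.tendsto_sqrt_atTop).comp
      tendsto_natCast_atTop_atTop).const_mul C
  rw [mul_zero] at hlim
  obtain ⟨N, hN⟩ := eventually_atTop.1 (hlim.eventually (gt_mem_nhds (half_pos hδ)))
  refine ⟨N, fun L hL => ?_⟩
  rw [Real.dist_eq, sub_zero, abs_of_nonneg (by positivity)]
  have h1 := hC L (by omega)
  have h2 := hN L hL.le
  have h3 : 2 * (δ / (4 * (k + 1))) * k ≤ δ / 2 := by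
    have : 2 * (δ / (4 * ((k : ℝ) + 1))) * k = δ / 2 * (k / (k + 1)) := by
      field_simp
      ring
    rw [this]
    exact mul_le_of_le_one_right (half_pos hδ).le ((div_le_one (by positivity)).2 (by linarith))
  linarith

/-- From `|exp(iy) - 1| ≤ |y|`; it turns `L¹` convergence to zero into convergence of characteristic
functions to `1`. -/
theorem norm_charFun_map_sub_one_le {Ω : Type*} [MeasurableSpace Ω] {P : Measure Ω}
    [IsProbabilityMeasure P] {Y : Ω → ℝ} (hY : Integrable Y P) :
    ‖charFun (P.map Y) 1 - 1‖ ≤ ∫ ω, |Y ω| ∂P := by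
  have hm := hY.aestronglyMeasurable.aemeasurable
  rw [charFun_apply_real, integral_map hm (by fun_prop)]
  have hint : Integrable (fun ω => Complex.exp ((1 : ℝ) * (Y ω : ℂ) * Complex.I)) P := by
    refine Integrable.of_bound (by fun_prop) 1 (ae_of_all _ fun ω => ?_)
    rw [Complex.ofReal_one, one_mul, Complex.norm_exp_ofReal_mul_I]
  have h1 : (1 : ℂ) = ∫ _, (1 : ℂ) ∂P := by simp
  conv_lhs => rw [h1]
  rw [← integral_sub (by simpa using hint) (integrable_const _)]
  refine norm_integral_le_of_norm_le hY.abs (ae_of_all _ fun ω => ?_)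
  have := Real.norm_exp_I_mul_ofReal_sub_one_le (x := Y ω)
  simpa [mul_comm] using this

/-- Were the limit zero, the characteristic function at `1` of the normalised box sum would tend to
`1`, whereas the central limit theorem gives `exp(-1/2)`. -/
theorem IsDisorderLaw.not_tendsto_integral_abs_sum (hν : IsDisorderLaw ν) :
    ¬ Tendsto (fun L : ℕ => (∫ η, |∑ i ∈ box 2 L, η i| ∂(disorderMeasure 2 ν)) / L)
      atTop (𝓝 0) := by
  intro hlim
  set P := disorderMeasure 2 ν with hP
  set v : ℝ := ∫ x, x ^ 2 ∂ν with hv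
  have hvpos : 0 < v :=
    (integral_nonneg fun x => sq_nonneg x).lt_of_ne' hν.second_moment_ne_zero
  set σ : ℝ := √v
  have hσ : 0 < σ := Real.sqrt_pos.2 hvpos
  have hmap : ∀ i : Site 2, P.map (fun η => η i) = ν := fun i =>
    Measure.infinitePi_map_eval (fun _ : Site 2 => ν) i
  have hint : ∀ i : Site 2, Integrable (fun η : Field 2 => η i) P := fun i => by
    have h : Integrable (fun x : ℝ => x) (P.map fun η => η i) := by
      rw [hmap]
      exact hν.memLp_two.integrable (by norm_num)
    exact h.comp_measurable (measurable_pi_apply i)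
  let X (i : Site 2) (η : Field 2) : ℝ := σ⁻¹ * η i
  have hX : ∀ i, Measurable (X i) := fun i => (measurable_pi_apply i).const_mul _
  have hXmap : ∀ i, P.map (X i) = ν.map (σ⁻¹ * ·) := fun i => by
    rw [← hmap i, Measure.map_map (by fun_prop) (by fun_prop)]
    rfl
  have h0 : P[X 0] = 0 := by
    have : ∫ η, η 0 ∂P = 0 := by
      rw [← hν.integral_eq_zero]
      conv_rhs => rw [← hmap 0]
      rw [integral_map (measurable_pi_apply 0).aemeasurable (by fun_prop)]
    simp only [X]
    rw [integral_const_mul, this, mul_zero]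
  have h1 : P[X 0 ^ 2] = 1 := by
    have : ∫ η, (η 0) ^ 2 ∂P = v := by
      rw [hv]
      conv_rhs => rw [← hmap 0]
      rw [integral_map (measurable_pi_apply 0).aemeasurable (by fun_prop)]
    simp only [X, Pi.pow_apply, mul_pow]
    rw [integral_const_mul, this, inv_pow, Real.sq_sqrt hvpos.le, inv_mul_cancel₀ hvpos.ne']
  have hind : iIndepFun X P :=
    iIndepFun_infinitePi (X := fun _ x => σ⁻¹ * x) fun _ => by fun_prop
  -- Only the subsequence `n = L ^ 2` matters: the box has `L ^ 2` sites and `√n = L`.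
  have hclt := (tendsto_charFun_inv_sqrt_mul_pow (hX 0).aemeasurable h0 h1 1).comp
    (tendsto_pow_atTop (α := ℕ) two_ne_zero)
  let Y (L : ℕ) (η : Field 2) : ℝ := (L : ℝ)⁻¹ * ∑ i ∈ box 2 L, X i η
  have hYint : ∀ L, Integrable (Y L) P := fun L =>
    (integrable_finsetSum _ fun i _ => (hint i).const_mul _).const_mul _
  have hchar : ∀ L : ℕ, charFun (P.map (Y L)) 1 =
      charFun (P.map (X 0)) ((√((L ^ 2 : ℕ) : ℝ))⁻¹ * 1) ^ (L ^ 2) := by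
    intro L
    rw [charFun_map_mul_comp (Finset.aemeasurable_fun_sum _ fun i _ => (hX i).aemeasurable),
      (hind.restrict _).charFun_map_fun_finsetSum_eq_prod fun i _ => (hX i).aemeasurable]
    simp only [hXmap, Finset.prod_const, card_box, Finset.prod_apply]
    congr 3
    rw [Nat.cast_pow, Real.sqrt_sq (Nat.cast_nonneg _)]
  have hY : Tendsto (fun L => ∫ η, |Y L η| ∂P) atTop (𝓝 0) := by
    have := hlim.const_mul σ⁻¹
    rw [mul_zero] at this
    refine this.congr fun L => ?_
    have habs : ∀ η, |Y L η| = (σ⁻¹ * (L : ℝ)⁻¹) * |∑ i ∈ box 2 L, η i| := by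
      intro η
      simp only [Y, X, ← Finset.mul_sum]
      rw [← mul_assoc, abs_mul, abs_of_nonneg (by positivity), mul_comm σ⁻¹]
    simp only [habs]
    rw [integral_const_mul]
    ring
  have hone : Tendsto (fun L => charFun (P.map (Y L)) 1) atTop (𝓝 1) := by
    rw [tendsto_iff_norm_sub_tendsto_zero]
    exact squeeze_zero (fun _ => norm_nonneg _)
      (fun L => norm_charFun_map_sub_one_le (hYint L)) hY
  have hlim' := tendsto_nhds_unique (hone.congr hchar) hclt
  have hre : Real.exp (-1 / 2) = 1 := by
    have := congrArg norm hlim'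
    rw [Complex.norm_exp] at this
    simpa using this.symm
  rw [Real.exp_eq_one_iff] at hre
  norm_num at hre

/-- In two dimensions, i.i.d. disorder is not a finite sum of integrable coboundaries. -/
theorem IsDisorderLaw.not_sum_coboundary (hν : IsDisorderLaw ν) {ι : Type*} [Fintype ι]
    (x : ι → Site 2) (Z : ι → Field 2 → ℝ)
    (hZ : ∀ s, Integrable (Z s) (disorderMeasure 2 ν)) :
    ¬ ∀ᵐ η ∂(disorderMeasure 2 ν), η 0 = ∑ s, (Z s η - Z s (shift (-x s) η)) := by
  intro h
  set P := disorderMeasure 2 ν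
  -- Stationarity moves the identity at the origin to each site, and countability makes it hold at
  -- all sites at once.
  have hall : ∀ᵐ η ∂P, ∀ i : Site 2,
      η i = ∑ s, (Z s (shift (-i) η) - Z s (shift (-(i + x s)) η)) := by
    refine ae_all_iff.2 fun i => ?_
    filter_upwards [(measurePreserving_shift ν (-i)).quasiMeasurePreserving.ae h] with η hη
    simp only [shift_shift, ← neg_add_rev] at hη
    simpa [shift] using hη
  refine hν.not_tendsto_integral_abs_sum ?_
  have hsum := tendsto_finsetSum (Finset.univ : Finset ι) fun s _ =>
    tendsto_integral_abs_sum_coboundary (hZ s) (x s)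
  rw [Finset.sum_const_zero] at hsum
  refine squeeze_zero (fun L => by positivity) (fun L => ?_) hsum
  rw [← Finset.sum_div]
  gcongr
  have hi : ∀ s, Integrable (fun η => |∑ i ∈ box 2 L,
      (Z s (shift (-i) η) - Z s (shift (-(i + x s)) η))|) P := fun s =>
    (integrable_finsetSum _ fun i _ =>
      (integrable_comp_shift (hZ s) _).sub (integrable_comp_shift (hZ s) _)).abs
  rw [← integral_finsetSum _ fun s _ => hi s]
  refine integral_mono_of_nonneg (ae_of_all _ fun η => abs_nonneg _)
    (integrable_finsetSum _ fun s _ => hi s) ?_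
  filter_upwards [hall] with η hη
  rw [Finset.sum_congr rfl fun i _ => hη i, Finset.sum_comm]
  exact Finset.abs_sum_le_sum_abs _ _

end Coboundary

/-! ### The divergence equation -/

/-- The edge `(0, -x)`. -/
def originEdge {d : ℕ} {p : Site d → ℝ} (x : {x : Site d // 0 < p x}) : Edge p :=
  ⟨(0, -x.1), by simpa using x.2⟩

/-- The increments of a gradient field along the edges leaving the origin. -/
def originIncrements {d : ℕ} {p : Site d → ℝ} (ψ : GradField p) : {x : Site d // 0 < p x} → ℝ :=
  fun x => ψ.1 (originEdge x)

theorem measurable_originIncrements {d : ℕ} {p : Site d → ℝ} :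
    Measurable (originIncrements (p := p)) :=
  measurable_pi_lambda _ fun _ => (measurable_pi_apply _).comp measurable_subtype_coe

/-- The increments at the origin after the height there has been raised by `t`. -/
def raise {d : ℕ} {p : Site d → ℝ} (u : {x : Site d // 0 < p x} → ℝ) (t : ℝ) :
    {x : Site d // 0 < p x} → ℝ :=
  -- When `p 0 > 0`, the step `0` is a loop at the origin, whose increment does not see the height.
  fun x => if x.1 = 0 then 0 else u x + t

theorem measurable_raise {d : ℕ} {p : Site d → ℝ} :
    Measurable fun q : ({x : Site d // 0 < p x} → ℝ) × ℝ => raise q.1 q.2 := by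
  refine measurable_pi_lambda _ fun x => ?_
  unfold raise
  split_ifs
  · exact measurable_const
  · fun_prop

/-- The energy at the origin in terms of the increments `u`, after raising the height by `t`. -/
def originEnergy {d : ℕ} (p : Site d → ℝ) [Fintype {x : Site d // 0 < p x}] (V : ℝ → ℝ) (a : ℝ)
    (u : {x : Site d // 0 < p x} → ℝ) (t : ℝ) : ℝ :=
  1 / 2 * (p 0 * V 0) + (∑ x : {x : Site d // 0 < p x}, if x.1 = 0 then 0 else p x.1 * V (u x + t))
    - a * t

/-! ### Single-site conditional law at the origin. -/

section Origin

variable {d : ℕ} {p : Site d → ℝ} [Fintype {x : Site d // 0 < p x}]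

/-- The neighbours are reindexed as `j = -x`, and the finitely supported sum is restricted to the
steps with `p x > 0`. -/
theorem energy_singleton_zero (hp : ∀ x, 0 ≤ p x) (V : ℝ → ℝ) (η φ : Field d) :
    energy p V η {0} φ = originEnergy p V (η 0) (fun x => -φ (-x.1)) (φ 0) := by
  have hfin : ∑ᶠ (j : Site d) (_ : j ∉ ({0} : Finset (Site d))), p (0 - j) * V (φ 0 - φ j) =
      ∑ x : {x : Site d // 0 < p x}, if x.1 = 0 then 0 else p x.1 * V (-φ (-x.1) + φ 0) := by
    let F : Site d → ℝ := fun x => if x = 0 then 0 else p x * V (-φ (-x) + φ 0)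
    have h1 : ∀ j : Site d, (∑ᶠ (_ : j ∉ ({0} : Finset (Site d))), p (0 - j) * V (φ 0 - φ j)) =
        F (Equiv.neg _ j) := by
      intro j
      by_cases hj : j = 0
      · simp [hj, F]
      · simp [hj, F, sub_eq_neg_add]
    rw [finsum_congr h1, finsum_comp_equiv (Equiv.neg (Site d))]
    have h2 : F.support ⊆ {x | 0 < p x} := by
      intro x hx
      refine (hp x).lt_of_ne fun h => hx ?_
      simp [F, ← h]
    rw [finsum_eq_sum_of_support_subset
      (s := Finset.univ.map (Function.Embedding.subtype fun x => 0 < p x)) F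
      (fun x hx => by simpa using h2 hx), Finset.sum_map]
    rfl
  unfold energy originEnergy
  simp only [Finset.sum_singleton, sub_self, hfin]

/-- The Boltzmann weight of raising the height at the origin by `t`. -/
def originWeight {d : ℕ} (p : Site d → ℝ) [Fintype {x : Site d // 0 < p x}] (V : ℝ → ℝ) (a : ℝ)
    (u : {x : Site d // 0 < p x} → ℝ) (t : ℝ) : ℝ≥0∞ :=
  ENNReal.ofReal (Real.exp (-originEnergy p V a u t))

theorem measurable_originEnergy {V : ℝ → ℝ} (hV : Measurable V) (a : ℝ) :
    Measurable fun q : ({x : Site d // 0 < p x} → ℝ) × ℝ => originEnergy p V a q.1 q.2 := by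
  unfold originEnergy
  refine (measurable_const.add (Finset.measurable_fun_sum _ fun x _ => ?_)).sub (by fun_prop)
  split_ifs
  · exact measurable_const
  · exact (hV.comp (by fun_prop)).const_mul _

theorem measurable_originWeight {V : ℝ → ℝ} (hV : Measurable V) (a : ℝ) :
    Measurable fun q : ({x : Site d // 0 < p x} → ℝ) × ℝ => originWeight p V a q.1 q.2 :=
  (Real.measurable_exp.comp (measurable_originEnergy hV a).neg).ennreal_ofReal

theorem measurable_originWeight_right {V : ℝ → ℝ} (hV : Measurable V) (a : ℝ)
    (u : {x : Site d // 0 < p x} → ℝ) : Measurable (originWeight p V a u) := by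
  have h := (measurable_originWeight (p := p) hV a).comp (measurable_prodMk_left (x := u))
  exact h

/-- The law of the increments at the origin under the single-site gradient Gibbs measure. -/
theorem lintegral_finiteGradGibbs_singleton (hp : ∀ x, 0 ≤ p x) {V : ℝ → ℝ} (hV : Measurable V)
    (η : Field d) (ψ : GradField p) {g : ({x : Site d // 0 < p x} → ℝ) → ℝ≥0∞}
    (hg : Measurable g) :
    ∫⁻ ψ', g (originIncrements ψ') ∂(finiteGradGibbs p V η {0} ψ) =
      (∫⁻ t, originWeight p V (η 0) (originIncrements ψ) t)⁻¹ *
        ∫⁻ t, originWeight p V (η 0) (originIncrements ψ) t *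
          g (raise (originIncrements ψ) t) := by
  set u := originIncrements ψ with hu
  -- Boundary heights are normalised to vanish at the origin, so the integrated spin is exactly the
  -- amount `t` of the raise; the gradient law does not notice the change.
  set b : Field d := fun i => heights ψ i - heights ψ 0 with hb
  have hub : ∀ x : {x : Site d // 0 < p x}, u x = -b (-x.1) := by
    intro x
    have := congrFun (congrArg Subtype.val (grad_heights ψ)) (originEdge x)
    simp only [grad, originEdge] at this
    simp only [hu, originIncrements, hb, originEdge]
    linarith
  have hgrad : grad p (heights ψ) = grad p b :=
    Subtype.ext (funext fun e => by simp [grad, hb])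
  let e := MeasurableEquiv.funUnique ({0} : Finset (Site d)) ℝ
  have hglue0 : ∀ x : ({0} : Finset (Site d)) → ℝ, glue {0} b x 0 = e x := by
    intro x
    simp only [glue, Finset.mem_singleton, dif_pos]
    rfl
  have hglue : ∀ (x : ({0} : Finset (Site d)) → ℝ) (i : Site d), i ≠ 0 → glue {0} b x i = b i := by
    intro x i hi
    simp [glue, hi]
  have hweight : weight p V η {0} b = fun x => originWeight p V (η 0) u (e x) := by
    funext x
    have : energy p V η {0} (glue {0} b x) = originEnergy p V (η 0) u (e x) := by
      rw [energy_singleton_zero hp, hglue0]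
      unfold originEnergy
      congr 2
      refine Finset.sum_congr rfl fun x _ => ?_
      split_ifs with hx
      · rfl
      · simp only [hub, hglue _ _ (neg_ne_zero.2 hx)]
    rw [weight, originWeight, this]
  have hinc : ∀ x, originIncrements (grad p (glue {0} b x)) = raise u (e x) := by
    intro x
    funext y
    simp only [originIncrements, grad, originEdge, raise, hglue0]
    split_ifs with hy
    · simp [hy, hglue0]
    · rw [hub, hglue _ _ (neg_ne_zero.2 hy)]
      ring
  have hvol := volume_preserving_funUnique ({0} : Finset (Site d)) ℝ
  have hw : Measurable (weight p V η {0} b) := by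
    rw [hweight]
    exact (measurable_originWeight_right hV (η 0) u).comp e.measurable
  have hgrad_inc : Measurable fun ψ' : GradField p => g (originIncrements ψ') :=
    hg.comp measurable_originIncrements
  have hfield : Measurable fun φ => g (originIncrements (grad p φ)) :=
    hgrad_inc.comp (measurable_grad p)
  have hspin : Measurable fun x => g (originIncrements (grad p (glue {0} b x))) :=
    hfield.comp (measurable_glue _ _)
  have hcomp : ∀ F : ℝ → ℝ≥0∞, ∫⁻ x, F (e x) = ∫⁻ t, F t := fun F =>
    hvol.lintegral_comp_emb e.measurableEmbedding F
  have hZ : partitionFn p V η {0} b = ∫⁻ t, originWeight p V (η 0) u t := by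
    rw [partitionFn, hweight]
    exact hcomp _
  rw [finiteGradGibbs, map_grad_finiteGibbs_eq hp V η {0} _ b hgrad,
    lintegral_map hgrad_inc (measurable_grad p), finiteGibbs, lintegral_smul_measure,
    lintegral_map hfield (measurable_glue _ _), lintegral_withDensity_eq_lintegral_mul _ hw hspin,
    hZ, smul_eq_mul]
  congr 1
  rw [← hcomp]
  refine lintegral_congr fun x => ?_
  rw [Pi.mul_apply, hinc, hweight]

end Origin

theorem IsPotential.deriv_neg {V : ℝ → ℝ} (hV : IsPotential V) (t : ℝ) :
    deriv V (-t) = -deriv V t := by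
  have h : (fun s => V (-s)) = V := funext hV.even
  conv_rhs => rw [← h, deriv_comp_neg]
  rw [neg_neg]

theorem IsPotential.deriv_zero {V : ℝ → ℝ} (hV : IsPotential V) : deriv V 0 = 0 := by
  have := hV.deriv_neg 0
  rw [neg_zero] at this
  linarith

/-! ### Integration by parts at the origin. -/

section Divergence

variable {d : ℕ} {p : Site d → ℝ} [Fintype {x : Site d // 0 < p x}] {V : ℝ → ℝ}

theorem hasDerivAt_originEnergy (hV : IsPotential V) (a : ℝ) (u : {x : Site d // 0 < p x} → ℝ)
    (t : ℝ) :
    HasDerivAt (originEnergy p V a u) ((∑ x, p x.1 * deriv V (raise u t x)) - a) t := by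
  have hd : ∀ s, HasDerivAt V (deriv V s) s := fun s =>
    (hV.contDiff.differentiable one_ne_zero s).hasDerivAt
  have hsum : HasDerivAt (fun t => ∑ x : {x : Site d // 0 < p x},
      if x.1 = 0 then 0 else p x.1 * V (u x + t)) (∑ x, p x.1 * deriv V (raise u t x)) t := by
    refine HasDerivAt.fun_sum fun x _ => ?_
    unfold raise
    split_ifs with hx
    -- A loop may be kept in the sum of forces because `V'(0) = 0`.
    · simpa [hV.deriv_zero] using hasDerivAt_const t (0 : ℝ)
    · exact ((hd (u x + t)).comp_const_add (u x) t).const_mul _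
  have := (hsum.const_add (1 / 2 * (p 0 * V 0))).sub ((hasDerivAt_id t).const_mul a)
  rw [mul_one] at this
  exact this

/-- The conditional law of the increments at the origin integrates the total force to zero. -/
theorem integral_exp_neg_originEnergy_mul_force (hV : IsPotential V) (a : ℝ)
    (u : {x : Site d // 0 < p x} → ℝ)
    (h : Integrable fun t => Real.exp (-originEnergy p V a u t))
    (h' : Integrable fun t => Real.exp (-originEnergy p V a u t) *
      ((∑ x, p x.1 * deriv V (raise u t x)) - a)) :
    ∫ t, Real.exp (-originEnergy p V a u t) * ((∑ x, p x.1 * deriv V (raise u t x)) - a) = 0 := by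
  -- The integrand is minus the derivative of the Boltzmann weight; integrability of both the weight
  -- and its derivative removes the boundary terms.
  have := integral_eq_zero_of_hasDerivAt_of_integrable
    (fun t => (hasDerivAt_originEnergy hV a u t).neg.exp)
    (by simpa only [mul_neg] using! h'.neg) h
  simp only [mul_neg] at this
  rw [integral_neg, neg_eq_zero] at this
  exact this

/-- The Schwinger-Dyson equation: the forces at the origin balance the disorder. -/
theorem IsGradientGibbs.sum_force (hp : ∀ x, 0 ≤ p x) (hV : IsPotential V) {η : Field d}
    {μ : Measure (GradField p)} (hμ : IsGradientGibbs p V η μ)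
    (hint : ∀ x : {x : Site d // 0 < p x},
      Integrable (fun ψ : GradField p => deriv V (ψ.1 (originEdge x))) μ) :
    ∑ x : {x : Site d // 0 < p x}, p x.1 * ∫ ψ, deriv V (ψ.1 (originEdge x)) ∂μ = η 0 := by
  have hVm : Measurable V := hV.contDiff.continuous.measurable
  have hV'm : Measurable (deriv V) := measurable_deriv V
  have := hμ.isProbabilityMeasure
  set m := μ.map originIncrements with hm
  have : IsProbabilityMeasure m :=
    Measure.isProbabilityMeasure_map measurable_originIncrements.aemeasurable
  set W := originWeight p V (η 0) with hW
  have hWm : Measurable fun q : ({x : Site d // 0 < p x} → ℝ) × ℝ => W q.1 q.2 :=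
    measurable_originWeight hVm (η 0)
  let Zinv (u : {x : Site d // 0 < p x} → ℝ) : ℝ≥0∞ := (∫⁻ t, W u t)⁻¹
  have hZm : Measurable Zinv := hWm.lintegral_prod_right'.inv
  let D (q : ({x : Site d // 0 < p x} → ℝ) × ℝ) : ℝ≥0∞ := Zinv q.1 * W q.1 q.2
  have hDm : Measurable D := (hZm.comp measurable_fst).mul hWm
  set M := (m.prod volume).withDensity D with hM
  let T (q : ({x : Site d // 0 < p x} → ℝ) × ℝ) : {x : Site d // 0 < p x} → ℝ := raise q.1 q.2
  have hT : Measurable T := measurable_raise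
  -- `M` is the joint law of old increments `u` and a raise `t` drawn from the conditional law given
  -- `u`; the DLR equation in `{0}` says that this resampling preserves `m`.
  have hmap : M.map T = m := by
    refine Measure.ext_of_lintegral _ fun g hg => ?_
    have hgT : Measurable fun q => g (T q) := hg.comp hT
    rw [lintegral_map hg hT, hM, lintegral_withDensity_eq_lintegral_mul _ hDm hgT,
      lintegral_prod _ (hDm.mul hgT).aemeasurable, hm,
      lintegral_map (hDm.mul hgT).lintegral_prod_right' measurable_originIncrements,
      lintegral_map hg measurable_originIncrements,
      ← hμ.dlr {0} (fun ψ => g (originIncrements ψ)) (hg.comp measurable_originIncrements)]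
    refine lintegral_congr fun ψ => ?_
    rw [lintegral_finiteGradGibbs_singleton hp hVm η ψ hg]
    simp only [Pi.mul_apply, D, T, mul_assoc]
    have hm1 : Measurable fun t => W (originIncrements ψ) t * g (raise (originIncrements ψ) t) :=
      (hWm.comp measurable_prodMk_left).mul (hgT.comp measurable_prodMk_left)
    rw [lintegral_const_mul _ hm1]
  -- The total mass is inherited from `m`. It makes the density `D` finite almost everywhere and, by
  -- Fubini, integrable in `t` for almost every `u`.
  have : IsProbabilityMeasure M := by
    refine ⟨?_⟩
    rw [← Set.preimage_univ (f := T), ← Measure.map_apply hT MeasurableSet.univ, hmap,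
      measure_univ]
  have hDtop : ∀ᵐ q ∂(m.prod volume), D q < ∞ := by
    refine ae_lt_top hDm ?_
    have : ∫⁻ q, D q ∂(m.prod volume) = M Set.univ := by
      rw [hM, withDensity_apply _ MeasurableSet.univ, Measure.restrict_univ]
    rw [this]
    exact measure_ne_top _ _
  have hDreal : ∀ q, (D q).toReal =
      (Zinv q.1).toReal * Real.exp (-originEnergy p V (η 0) q.1 q.2) := by
    intro q
    simp only [D, hW, originWeight, ENNReal.toReal_mul,
      ENNReal.toReal_ofReal (Real.exp_pos _).le]
  have hfm : ∀ x : {x : Site d // 0 < p x},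
      Measurable fun u : {x : Site d // 0 < p x} → ℝ => deriv V (u x) := fun x =>
    hV'm.comp (measurable_pi_apply x)
  have hfint : ∀ x, Integrable (fun u : {x : Site d // 0 < p x} → ℝ => deriv V (u x)) m := by
    intro x
    rw [hm, integrable_map_measure (hfm x).aestronglyMeasurable
      measurable_originIncrements.aemeasurable]
    exact hint x
  let G (u : {x : Site d // 0 < p x} → ℝ) : ℝ := (∑ x, p x.1 * deriv V (u x)) - η 0
  have hGint : Integrable G m :=
    (integrable_finsetSum _ fun x _ => (hfint x).const_mul _).sub (integrable_const _)
  have hG : ∫ u, G u ∂m =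
      (∑ x : {x : Site d // 0 < p x}, p x.1 * ∫ ψ, deriv V (ψ.1 (originEdge x)) ∂μ) - η 0 := by
    simp only [G]
    rw [integral_sub (integrable_finsetSum _ fun x _ => (hfint x).const_mul _)
      (integrable_const _), integral_finsetSum _ fun x _ => (hfint x).const_mul _]
    congr 1
    · refine Finset.sum_congr rfl fun x _ => ?_
      rw [integral_const_mul, hm, integral_map measurable_originIncrements.aemeasurable
        (hfm x).aestronglyMeasurable]
      rfl
    · simp
  have hGT : Integrable (fun q => G (T q)) M := by
    rw [← hmap] at hGint
    exact hGint.comp_measurable hT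
  have hGT' := (integrable_withDensity_iff_integrable_smul' hDm hDtop).1 hGT
  have hone := (integrable_withDensity_iff_integrable_smul' hDm hDtop).1
    (integrable_const (1 : ℝ) : Integrable (fun _ => (1 : ℝ)) M)
  suffices h : ∫ u, G u ∂m = 0 by linarith
  rw [← hmap, integral_map hT.aemeasurable (by rw [hmap]; exact hGint.aestronglyMeasurable), hM,
    integral_withDensity_eq_integral_toReal_smul hDm hDtop, integral_prod _ hGT']
  refine integral_eq_zero_of_ae ?_
  filter_upwards [hGT'.prod_right_ae, hone.prod_right_ae] with u h1 h2
  simp only [hDreal, smul_eq_mul, mul_one, mul_assoc] at h1 h2 ⊢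
  rw [integral_const_mul]
  -- A degenerate normalisation contributes zero; otherwise it is a nonzero constant that can be
  -- divided out of the fibrewise integrability.
  rcases eq_or_ne (Zinv u).toReal 0 with h0 | h0
  · simp [h0]
  · rw [integrable_const_mul_iff (Ne.isUnit h0)] at h1 h2
    have := integral_exp_neg_originEnergy_mul_force hV (η 0) u h2 h1
    simp only [G, T] at this ⊢
    rw [this]
    simp

end Divergence

/-! ### Covariance of the forces -/

theorem measurable_gradShift {d : ℕ} {p : Site d → ℝ} (r : Site d) :
    Measurable (gradShift (p := p) r) := by
  have h : Measurable fun ψ : GradField p => (gradShift r ψ).1 :=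
    measurable_pi_lambda _ fun e =>
      (measurable_pi_apply (edgeShift r e)).comp measurable_subtype_coe
  exact h.subtype_mk (h := fun ψ => (gradShift r ψ).2)

/-- The expected force along an edge. -/
def force {d : ℕ} {p : Site d → ℝ} (V : ℝ → ℝ) (μ : Kernel (Field d) (GradField p)) (e : Edge p)
    (η : Field d) : ℝ :=
  ∫ ψ, deriv V (ψ.1 e) ∂(μ η)

/-- Covariance says that `μ (shift r η)` is the image of `μ η` under `gradShift r`, so this is a
change of variables. -/
theorem IsCovariantGradientGibbs.force_shift {d : ℕ} {p : Site d → ℝ} {V : ℝ → ℝ}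
    {P : Measure (Field d)} {μ : Kernel (Field d) (GradField p)}
    (hμ : IsCovariantGradientGibbs p V P μ) (r : Site d) (e : Edge p) :
    ∀ᵐ η ∂P, force V μ e (shift r η) = force V μ (edgeShift r e) η := by
  filter_upwards [hμ.covariant r] with η hη
  have h : μ (shift r η) = (μ η).map (gradShift r) := by
    refine Measure.ext_of_lintegral _ fun f hf => ?_
    rw [lintegral_map hf (measurable_gradShift r)]
    exact hη f hf
  have hm : Measurable fun ψ : GradField p => deriv V (ψ.1 e) :=
    (measurable_deriv V).comp ((measurable_pi_apply e).comp measurable_subtype_coe)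
  rw [force, h, integral_map (measurable_gradShift r).aemeasurable hm.aestronglyMeasurable]
  rfl

/-- The reversed edge. -/
def edgeSwap {d : ℕ} {p : Site d → ℝ} (hp : IsWalkKernel p) (e : Edge p) : Edge p :=
  ⟨(e.1.2, e.1.1), by rw [← neg_sub, hp.symm]; exact e.2⟩

theorem force_edgeSwap {d : ℕ} {p : Site d → ℝ} (hp : IsWalkKernel p) {V : ℝ → ℝ}
    (hV : IsPotential V) (μ : Kernel (Field d) (GradField p)) (e : Edge p) (η : Field d) :
    force V μ (edgeSwap hp e) η = -force V μ e η := by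
  have : ∀ ψ : GradField p, deriv V (ψ.1 (edgeSwap hp e)) = -deriv V (ψ.1 e) := by
    intro ψ
    rw [← hV.deriv_neg]
    congr 1
    obtain ⟨φ, hφ⟩ := ψ.2
    rw [hφ, hφ]
    simp [edgeSwap]
  simp only [force, this, integral_neg]

/-- The reflection of the steps of the walk. -/
def negStep {d : ℕ} {p : Site d → ℝ} (hp : IsWalkKernel p) :
    {x : Site d // 0 < p x} ≃ {x : Site d // 0 < p x} :=
  (Equiv.neg (Site d)).subtypeEquiv fun x => by simp [hp.symm]

/-- Translating `(0, -x)` by `x` gives `(x, 0)`, the reversal of `(0, x)`; the sign comes from `V'`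
being odd. -/
theorem IsCovariantGradientGibbs.force_negStep {d : ℕ} {p : Site d → ℝ} (hp : IsWalkKernel p)
    {V : ℝ → ℝ} (hV : IsPotential V) {P : Measure (Field d)}
    {μ : Kernel (Field d) (GradField p)} (hμ : IsCovariantGradientGibbs p V P μ)
    (x : {x : Site d // 0 < p x}) :
    ∀ᵐ η ∂P, force V μ (originEdge (negStep hp x)) η =
      -force V μ (originEdge x) (shift (-x.1) η) := by
  filter_upwards [hμ.force_shift (-x.1) (originEdge x)] with η hη
  rw [hη, ← force_edgeSwap hp hV]
  congr 1
  refine Subtype.ext (Prod.ext ?_ ?_) <;> simp [edgeSwap, edgeShift, originEdge, negStep]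

end GradGibbs

end

/-! ### The contradiction. -/

theorem theorem1p1 (V : ℝ → ℝ) (hV : GradGibbs.IsPotential V)
    (p : GradGibbs.Site 2 → ℝ) (hp : GradGibbs.IsWalkKernel p)
    (ν : Measure ℝ) (hν : GradGibbs.IsDisorderLaw ν) :
    ¬ ∃ μ : Kernel (GradGibbs.Field 2) (GradGibbs.GradField p),
      GradGibbs.IsCovariantGradientGibbs p V (GradGibbs.disorderMeasure 2 ν) μ ∧
      GradGibbs.HasIntegrableForce p V (GradGibbs.disorderMeasure 2 ν) μ := by
  rintro ⟨μ, hμ, hint⟩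
  have := hν.isProbabilityMeasure
  have : Finite {x : GradGibbs.Site 2 // 0 < p x} :=
    hp.finite_range.subset fun x hx => ne_of_gt hx
  have := Fintype.ofFinite {x : GradGibbs.Site 2 // 0 < p x}
  -- The factor `1 / 2` comes from averaging the divergence identity with its image under `x ↦ -x`.
  let Z (x : {x : GradGibbs.Site 2 // 0 < p x}) (η : GradGibbs.Field 2) : ℝ :=
    p x.1 / 2 * GradGibbs.force V μ (GradGibbs.originEdge x) η
  refine hν.not_sum_coboundary (fun x : {x : GradGibbs.Site 2 // 0 < p x} => x.1) Z
    (fun x => (hint (GradGibbs.originEdge x)).2.const_mul _) ?_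
  filter_upwards [hμ.gibbs, ae_all_iff.2 fun x => (hint (GradGibbs.originEdge x)).1,
    ae_all_iff.2 fun x => hμ.force_negStep hp hV x] with η hgibbs hη hneg
  have hdiv : ∑ x : {x : GradGibbs.Site 2 // 0 < p x},
      p x.1 * GradGibbs.force V μ (GradGibbs.originEdge x) η = η 0 :=
    hgibbs.sum_force hp.nonneg hV hη
  have hflip : ∑ x : {x : GradGibbs.Site 2 // 0 < p x},
      p x.1 * GradGibbs.force V μ (GradGibbs.originEdge x) (GradGibbs.shift (-x.1) η) = -η 0 := by
    rw [← hdiv, ← (GradGibbs.negStep hp).sum_comp fun x : {x : GradGibbs.Site 2 // 0 < p x} =>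
      p x.1 * GradGibbs.force V μ (GradGibbs.originEdge x) η, ← Finset.sum_neg_distrib]
    refine Finset.sum_congr rfl fun x _ => ?_
    have hpx : p (GradGibbs.negStep hp x).1 = p x.1 := hp.symm x.1
    rw [hneg x, hpx]
    ring
  have hsplit : ∑ x, (Z x η - Z x (GradGibbs.shift (-x.1) η)) = (η 0 - -η 0) / 2 := by
    rw [← hflip, ← hdiv, ← Finset.sum_sub_distrib, Finset.sum_div]
    refine Finset.sum_congr rfl fun x _ => ?_
    simp only [Z]
    ring
  rw [hsplit]
  ring
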